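/- Let $\kappa$ be a nonzero cardinal. The following are equivalent. (1) $\kappa$ is second-order reflective: for every first-order language $L$ with fewer than $\kappa$ symbols, every $L$-structure $M$ (of any size) with $\kappa\subseteq M$, and every second-order $L$-sentence $\varphi$ true in $M$ (with full second-order semantics), there is a first-order elementary substructure $m\prec M$ of size less than $\kappa$ such that $m\cap\kappa\in\kappa$ and $\varphi$ is true in $m$. (2) $\kappa$ is reflective for $\Pi^1_1$ assertions: the same, but only for $\Pi^1_1$ sentences $\varphi$, that is, those consisting of a finite block of universal second-order quantifiers followed by a formula without second-order quantifiers. (3) $\kappa$ is supercompact: $\kappa$ is uncountable and, for every set $A$ with $|A|\geq\kappa$, the set $P_\kappa(A)=\{s\subseteq A : |s|<\kappa\}$ carries a normal fine measure, that is, a $\kappa$-complete ultrafilter $U$ such that $\{s : a\in s\}\in U$ for every $a\in A$, and such that every $f:P_\kappa(A)\to A$ with $\{s : f(s)\in s\}\in U$ is constant on a set in $U$. -/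

import Mathlib

open Cardinal

universe u v w

/-! ### Second-order logic over a first-order language

A context of relation variables is the list of their arities (de Bruijn style: the variable bound
most recently comes first). -/

/-- `RelVar Γ k`: the `k`-ary relation variables in the context `Γ`. -/
inductive RelVar : List ℕ → ℕ → Type
  | zero {k : ℕ} {Γ : List ℕ} : RelVar (k :: Γ) k
  | succ {j k : ℕ} {Γ : List ℕ} : RelVar Γ k → RelVar (j :: Γ) k

/-- `SOFormula L Γ n`: second-order formulas in the language `L` whose free relation variables are
those of the context `Γ` and whose free individual variables are indexed by `Fin n`. The
quantifier `all` binds the individual variable with the last index, and `allRel k` binds a `k`-ary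
relation variable. The other connectives and quantifiers are classical abbreviations. -/
inductive SOFormula (L : FirstOrder.Language.{v, w}) : List ℕ → ℕ → Type (max v w)
  | falsum {Γ : List ℕ} {n : ℕ} : SOFormula L Γ n
  | equal {Γ : List ℕ} {n : ℕ} (t₁ t₂ : L.Term (Fin n)) : SOFormula L Γ n
  | rel {Γ : List ℕ} {n k : ℕ} (R : L.Relations k) (ts : Fin k → L.Term (Fin n)) :
      SOFormula L Γ n
  | relVar {Γ : List ℕ} {n k : ℕ} (X : RelVar Γ k) (ts : Fin k → L.Term (Fin n)) :
      SOFormula L Γ n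
  | imp {Γ : List ℕ} {n : ℕ} (φ ψ : SOFormula L Γ n) : SOFormula L Γ n
  | all {Γ : List ℕ} {n : ℕ} (φ : SOFormula L Γ (n + 1)) : SOFormula L Γ n
  | allRel {Γ : List ℕ} {n : ℕ} (k : ℕ) (φ : SOFormula L (k :: Γ) n) : SOFormula L Γ n

/-- Second-order sentences: no free variables of either kind. -/
abbrev SOSentence (L : FirstOrder.Language.{v, w}) : Type (max v w) := SOFormula L [] 0

/-- An assignment of relations on `M` to the relation variables of the context `Γ`. -/
abbrev RelAssignment (M : Type u) (Γ : List ℕ) : Type u :=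
  ∀ k : ℕ, RelVar Γ k → Set (Fin k → M)

/-- The assignment for the empty context. -/
def RelAssignment.nil (M : Type u) : RelAssignment M [] := nofun

/-- Extend an assignment by a value for the most recent relation variable. -/
def RelAssignment.cons {M : Type u} {j : ℕ} {Γ : List ℕ} (Y : Set (Fin j → M))
    (ρ : RelAssignment M Γ) : RelAssignment M (j :: Γ)
  | _, .zero => Y
  | k, .succ X => ρ k X

namespace SOFormula

variable {L : FirstOrder.Language.{v, w}}

/-- Full (Tarskian) semantics: relation variables of arity `k` range over all `k`-ary relations on
the domain. -/
def Realize {M : Type u} [L.Structure M] : ∀ {Γ : List ℕ} {n : ℕ},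
    SOFormula L Γ n → RelAssignment M Γ → (Fin n → M) → Prop
  | _, _, falsum, _, _ => False
  | _, _, equal t₁ t₂, _, x => t₁.realize x = t₂.realize x
  | _, _, rel R ts, _, x => FirstOrder.Language.Structure.RelMap R fun i => (ts i).realize x
  | _, _, relVar X ts, ρ, x => (fun i => (ts i).realize x) ∈ ρ _ X
  | _, _, imp φ ψ, ρ, x => φ.Realize ρ x → ψ.Realize ρ x
  | _, _, all φ, ρ, x => ∀ a : M, φ.Realize ρ (Fin.snoc x a)
  | _, _, allRel k φ, ρ, x => ∀ Y : Set (Fin k → M), φ.Realize (RelAssignment.cons Y ρ) x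

/-- The formula has no second-order quantifiers (relation variables may occur free). -/
def IsFirstOrder : ∀ {Γ : List ℕ} {n : ℕ}, SOFormula L Γ n → Prop
  | _, _, falsum => True
  | _, _, equal _ _ => True
  | _, _, rel _ _ => True
  | _, _, relVar _ _ => True
  | _, _, imp φ ψ => φ.IsFirstOrder ∧ ψ.IsFirstOrder
  | _, _, all φ => φ.IsFirstOrder
  | _, _, allRel _ _ => False

/-- `Π¹₁` formulas: a finite block of universal second-order quantifiers followed by a formula
without second-order quantifiers. -/
inductive IsPi11 : ∀ {Γ : List ℕ} {n : ℕ}, SOFormula L Γ n → Prop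
  | of_isFirstOrder {Γ : List ℕ} {n : ℕ} {φ : SOFormula L Γ n} : φ.IsFirstOrder → IsPi11 φ
  | allRel {Γ : List ℕ} {n : ℕ} (k : ℕ) {φ : SOFormula L (k :: Γ) n} :
      IsPi11 φ → IsPi11 (SOFormula.allRel k φ)

end SOFormula

/-- The second-order sentence `φ` is true in the structure `M`. -/
def SOSentence.IsTrueIn {L : FirstOrder.Language.{v, w}} (φ : SOSentence L) (M : Type u) [L.Structure M] :
    Prop :=
  SOFormula.Realize φ (RelAssignment.nil M) Fin.elim0

/-! ### Reflective cardinals -/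

/-- Reflection of the sentence `φ` from the structure `M` to a small elementary substructure. The
inclusion `κ ⊆ M` is represented by the injection `e` of the initial ordinal `κ` into `M`; the
condition `m ∩ κ ∈ κ` says that the elements of `κ` lying in `m` are exactly the predecessors of
some `α < κ`. -/
def ReflectsBelow (κ : Cardinal.{u}) {L : FirstOrder.Language.{u, u}} (φ : SOSentence L) (M : Type u)
    [L.Structure M] (e : κ.ord.ToType ↪ M) : Prop :=
  ∃ m : L.ElementarySubstructure M,
    #m < κ ∧ (∃ α : κ.ord.ToType, ∀ β : κ.ord.ToType, e β ∈ m ↔ β < α) ∧ φ.IsTrueIn m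

/-- `κ` is second-order reflective: every second-order sentence true in a structure `M ⊇ κ`, of any
size, in a language with fewer than `κ` symbols, is true in some elementary substructure `m ≺ M` of
size less than `κ` with `m ∩ κ ∈ κ`. -/
def IsSecondOrderReflective (κ : Cardinal.{u}) : Prop :=
  ∀ (L : FirstOrder.Language.{u, u}), L.card < κ → ∀ (M : Type u) [L.Structure M] (e : κ.ord.ToType ↪ M)
    (φ : SOSentence L), φ.IsTrueIn M → ReflectsBelow κ φ M e

/-- `κ` is reflective for `Π¹₁` assertions. -/
def IsPi11Reflective (κ : Cardinal.{u}) : Prop :=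
  ∀ (L : FirstOrder.Language.{u, u}), L.card < κ → ∀ (M : Type u) [L.Structure M] (e : κ.ord.ToType ↪ M)
    (φ : SOSentence L), SOFormula.IsPi11 φ → φ.IsTrueIn M → ReflectsBelow κ φ M e

/-! ### Supercompact cardinals -/

/-- `P_κ(A)`: the subsets of `A` of size less than `κ`. -/
abbrev SmallSubsets (κ : Cardinal.{u}) (A : Type u) : Type u := {s : Set A // #s < κ}

/-- `U` is a normal fine measure on `P_κ(A)`: a `κ`-complete ultrafilter that is fine and such that
every function regressive on a set in `U` is constant on a set in `U`. -/
structure IsNormalFineMeasure (κ : Cardinal.{u}) (A : Type u)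
    (U : Ultrafilter (SmallSubsets κ A)) : Prop where
  complete : CardinalInterFilter (U : Filter (SmallSubsets κ A)) κ
  fine : ∀ a : A, {s : SmallSubsets κ A | a ∈ s.1} ∈ U
  normal : ∀ f : SmallSubsets κ A → A, {s : SmallSubsets κ A | f s ∈ s.1} ∈ U →
    ∃ a : A, {s : SmallSubsets κ A | f s = a} ∈ U

/-- `κ` is supercompact: it is uncountable, and `P_κ(A)` carries a normal fine measure for every set
`A` of size at least `κ`. -/
def IsSupercompact (κ : Cardinal.{u}) : Prop :=
  ℵ₀ < κ ∧ ∀ A : Type u, κ ≤ #A →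
    ∃ U : Ultrafilter (SmallSubsets κ A), IsNormalFineMeasure κ A U

/-!
From a normal fine measure `U` on `P_κ(M)` one gets reflection by a Łoś theorem that needs no
ultrapower: a second-order formula holds in `M` if and only if it holds in almost every `s ∈ P_κ(M)`
(`IsNormalFineMeasure.realize_iff_eventually_realizeOn`). Normality, in the form of closure under
diagonal intersections over finite tuples (`IsNormalFineMeasure.eventually_forall_tuple`), treats
the individual quantifiers, and also the relation quantifiers: if `Y s` is a relation on `s` for
almost every `s`, then `{x | ∀ᶠ s in U, x ∈ Y s}` is a relation on `M` whose trace on almost every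
`s` is `Y s`. The same principle, applied to fewer than `κ` functions and formulas, shows that almost
every `s` is an elementary substructure, and by fineness and `κ`-completeness almost every `s` meets
`κ` in an element of `κ`.

Conversely, let `κ` reflect `Π¹₁` sentences. The sentences bounding finite cardinalities show that
`κ` is uncountable. Let `κ` embed in `A`, and suppose that no family `D` of subsets of `P_κ(A)` is a
normal fine measure. Each `D` then has a point `c D` and sets `F D n a`, for `a : A`, which show this,
in the sense that `D` does not agree on the sets `F D n a`, `a ∈ t`, with the principal ultrafilter
at any `t` that contains `c D` and is closed downwards in `κ`
(`exists_isNormalFineMeasure_of_approximates`). Make the points, the subsets of `P_κ(A)` and the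
families of these into one structure with `c` and `F` as Skolem functions. The `Π¹₁` sentence saying
that every class of sets is a family reflects to a small substructure `m`. Let `t ∈ P_κ(A)` consist
of the points in `m`. Some family `D` in `m` has as members in `m` exactly the sets in `m` to which
`t` belongs; as `m` is closed under the functions, `t` agrees with `D` on the sets `F D n a` for
`a ∈ t`, a contradiction (`IsPi11Reflective.exists_approximates`).
-/

open Filter FirstOrder

/-! ### Relativised semantics -/

namespace SOFormula

variable {L : FirstOrder.Language.{v, w}}

/-- `φ.RealizeOn s ρ x`: the formula `φ` with its individual quantifiers bounded by `s ⊆ M`. The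
relation quantifiers still range over all relations on `M`, and the terms are evaluated in `M`; when
`s` is closed under the functions and contains `x`, only the traces of the relations on `s` matter,
so that this is the truth of `φ` in the substructure `s` (`realizeOn_iff_realize`). -/
def RealizeOn {M : Type u} [L.Structure M] (s : Set M) : ∀ {Γ : List ℕ} {n : ℕ},
    SOFormula L Γ n → RelAssignment M Γ → (Fin n → M) → Prop
  | _, _, falsum, _, _ => False
  | _, _, equal t₁ t₂, _, x => t₁.realize x = t₂.realize x
  | _, _, rel R ts, _, x => FirstOrder.Language.Structure.RelMap R fun i => (ts i).realize x
  | _, _, relVar X ts, ρ, x => (fun i => (ts i).realize x) ∈ ρ _ X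
  | _, _, imp φ ψ, ρ, x => φ.RealizeOn s ρ x → ψ.RealizeOn s ρ x
  | _, _, all φ, ρ, x => ∀ a ∈ s, φ.RealizeOn s ρ (Fin.snoc x a)
  | _, _, allRel k φ, ρ, x =>
      ∀ Y : Set (Fin k → M), φ.RealizeOn s (RelAssignment.cons Y ρ) x

end SOFormula

/-- The traces on `S` of the relations of an assignment on `M`. -/
def RelAssignment.restrict {M : Type u} {Γ : List ℕ} (ρ : RelAssignment M Γ) (S : Set M) :
    RelAssignment S Γ :=
  fun k X => {y | (fun i => (y i : M)) ∈ ρ k X}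

theorem RelAssignment.restrict_cons {M : Type u} {Γ : List ℕ} (ρ : RelAssignment M Γ) (S : Set M)
    {k : ℕ} (Y : Set (Fin k → M)) :
    (RelAssignment.cons Y ρ).restrict S =
      RelAssignment.cons {y : Fin k → S | (fun i => (y i : M)) ∈ Y} (ρ.restrict S) := by
  funext j X
  cases X <;> rfl

theorem RelAssignment.restrict_nil {M : Type u} (S : Set M) :
    (RelAssignment.nil M).restrict S = RelAssignment.nil S := by
  funext j X
  cases X

namespace SOFormula

variable {L : FirstOrder.Language.{v, w}} {M : Type u} [L.Structure M]

theorem realizeOn_iff_realize (S : L.Substructure M) {Γ : List ℕ} {n : ℕ} (φ : SOFormula L Γ n)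
    (ρ : RelAssignment M Γ) (x : Fin n → S) :
    φ.RealizeOn (S : Set M) ρ (fun i => (x i : M)) ↔
      φ.Realize (M := S) (ρ.restrict (S : Set M)) x := by
  have hterm : ∀ {n : ℕ} (t : L.Term (Fin n)) (x : Fin n → S),
      t.realize (fun i => (x i : M)) = (t.realize x : S) := fun t x =>
    Language.HomClass.realize_term S.subtype
  induction φ with
  | falsum => exact Iff.rfl
  | equal t₁ t₂ => simp only [RealizeOn, Realize, hterm, Subtype.ext_iff]
  | rel R ts => simp only [RealizeOn, Realize, hterm]; rfl
  | relVar X ts => simp only [RealizeOn, Realize, hterm]; rfl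
  | imp φ ψ ihφ ihψ => simp only [RealizeOn, Realize, ihφ, ihψ]
  | all φ ih =>
    have hsnoc : ∀ a : S, (Fin.snoc (fun i => (x i : M)) (a : M) : Fin _ → M) =
        fun i => ((Fin.snoc x a : Fin _ → S) i : M) := by
      intro a
      funext i
      refine Fin.lastCases ?_ (fun i => ?_) i <;> simp
    constructor
    · intro h a
      have := h a a.2
      rw [hsnoc] at this
      exact (ih _ _).1 this
    · intro h a ha
      have := (ih ρ _).2 (h ⟨a, ha⟩)
      rw [← hsnoc] at this
      exact this
  | allRel k φ ih =>
    constructor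
    · intro h Y
      have := (ih _ _).1 (h ((fun y : Fin k → S => fun i => (y i : M)) '' Y))
      rw [RelAssignment.restrict_cons] at this
      have hY : {y : Fin k → S | (fun i => (y i : M)) ∈
          (fun y : Fin k → S => fun i => (y i : M)) '' Y} = Y := by
        ext y
        refine ⟨?_, fun hy => ⟨y, hy, rfl⟩⟩
        rintro ⟨z, hz, hzy⟩
        have : z = y := funext fun i => Subtype.ext (congrFun hzy i)
        exact this ▸ hz
      erw [hY] at this
      exact this
    · intro h Y
      refine (ih _ _).2 ?_
      rw [RelAssignment.restrict_cons]
      exact h _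

theorem realizeOn_cons_congr (S : L.Substructure M) {Γ : List ℕ} {n k : ℕ}
    (φ : SOFormula L (k :: Γ) n) (ρ : RelAssignment M Γ) {x : Fin n → M} (hx : ∀ i, x i ∈ S)
    {Y Z : Set (Fin k → M)} (h : ∀ y : Fin k → M, (∀ i, y i ∈ S) → (y ∈ Y ↔ y ∈ Z)) :
    φ.RealizeOn (S : Set M) (RelAssignment.cons Y ρ) x ↔
      φ.RealizeOn (S : Set M) (RelAssignment.cons Z ρ) x := by
  have := realizeOn_iff_realize S φ (RelAssignment.cons Y ρ) (fun i => ⟨x i, hx i⟩)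
  have hZ := realizeOn_iff_realize S φ (RelAssignment.cons Z ρ) (fun i => ⟨x i, hx i⟩)
  refine this.trans (Iff.trans ?_ hZ.symm)
  rw [RelAssignment.restrict_cons, RelAssignment.restrict_cons]
  have hYZ : {y : Fin k → (S : Set M) | (fun i => (y i : M)) ∈ Y} =
      {y : Fin k → (S : Set M) | (fun i => (y i : M)) ∈ Z} :=
    Set.ext fun y => h _ fun i => (y i).2
  rw [hYZ]

end SOFormula

theorem mk_Iio_ord_toType_lt {κ : Cardinal.{u}} (β : κ.ord.ToType) : #(Set.Iio β) < κ := by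
  simpa using mk_Iio_lt β (by simp)

/-! ### Almost every small subset -/

namespace IsNormalFineMeasure

variable {κ : Cardinal.{u}} {A : Type u} {U : Ultrafilter (SmallSubsets κ A)}

/-- Closure of the measure under diagonal intersections indexed by finite tuples. -/
theorem eventually_forall_tuple (hU : IsNormalFineMeasure κ A U) {k : ℕ}
    {p : (Fin k → A) → SmallSubsets κ A → Prop} (hp : ∀ x, ∀ᶠ s : SmallSubsets κ A in U, p x s) :
    ∀ᶠ s : SmallSubsets κ A in U, ∀ x : Fin k → A, (∀ i, x i ∈ s.1) → p x s := by
  by_contra hcon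
  rw [← Ultrafilter.eventually_not] at hcon
  -- a tuple of counterexamples is regressive in every coordinate, hence constant
  have hx : ∀ s : SmallSubsets κ A, ∃ x : Fin k → A,
      (¬ ∀ x : Fin k → A, (∀ i, x i ∈ s.1) → p x s) → (∀ i, x i ∈ s.1) ∧ ¬ p x s := by
    intro s
    by_cases h : ∀ x : Fin k → A, (∀ i, x i ∈ s.1) → p x s
    · by_cases hA : Nonempty (Fin k → A)
      · exact ⟨hA.some, fun h' => absurd h h'⟩
      · have : ∀ᶠ s : SmallSubsets κ A in U, ∀ x : Fin k → A, (∀ i, x i ∈ s.1) → p x s :=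
          Eventually.of_forall fun s x => absurd ⟨x⟩ hA
        exact absurd this (Ultrafilter.eventually_not.1 hcon)
    · push Not at h
      obtain ⟨x, h1, h2⟩ := h
      exact ⟨x, fun _ => ⟨h1, h2⟩⟩
  choose x hx using hx
  have hconst : ∀ i, ∃ a, ∀ᶠ s : SmallSubsets κ A in U, x s i = a := fun i =>
    hU.normal (fun s => x s i) (hcon.mono fun s hs => (hx s hs).1 i)
  choose a ha using hconst
  have hfalse : ∀ᶠ _s : SmallSubsets κ A in U, False := by
    filter_upwards [hcon, eventually_all.2 ha, hp a] with s hs hsa hpa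
    exact (hx s hs).2 ((funext hsa : x s = a) ▸ hpa)
  exact hfalse.exists.elim fun _ h => h

theorem eventually_forall_mem (hU : IsNormalFineMeasure κ A U)
    {p : A → SmallSubsets κ A → Prop} (hp : ∀ a, ∀ᶠ s : SmallSubsets κ A in U, p a s) :
    ∀ᶠ s : SmallSubsets κ A in U, ∀ a ∈ s.1, p a s := by
  filter_upwards [hU.eventually_forall_tuple (k := 1) (p := fun x => p (x 0)) fun x => hp _]
    with s hs a ha
  exact hs (fun _ => a) fun _ => ha

theorem eventually_forall_of_card_lt (hU : IsNormalFineMeasure κ A U) {ι : Type u} (hι : #ι < κ)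
    {p : SmallSubsets κ A → ι → Prop} (hp : ∀ i, ∀ᶠ s : SmallSubsets κ A in U, p s i) :
    ∀ᶠ s : SmallSubsets κ A in U, ∀ i, p s i :=
  have := hU.complete
  (eventually_cardinal_forall hι).2 hp

theorem eventually_tuple_mem (hU : IsNormalFineMeasure κ A U) {n : ℕ} (x : Fin n → A) :
    ∀ᶠ s : SmallSubsets κ A in U, ∀ i, x i ∈ s.1 :=
  eventually_all.2 fun i => hU.fine (x i)

/-- Almost every `s` meets an injected copy of `κ` in a proper initial segment. -/
theorem eventually_inter_eq_Iio (hU : IsNormalFineMeasure κ A U) (e : κ.ord.ToType ↪ A) :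
    ∀ᶠ s : SmallSubsets κ A in U, ∃ α : κ.ord.ToType, ∀ β, e β ∈ s.1 ↔ β < α := by
  have hlower : ∀ᶠ s : SmallSubsets κ A in U, ∀ a ∈ s.1, ∀ β, e β = a → ∀ γ < β, e γ ∈ s.1 := by
    refine hU.eventually_forall_mem fun a => ?_
    by_cases h : ∃ β, e β = a
    · obtain ⟨β, rfl⟩ := h
      filter_upwards [hU.eventually_forall_of_card_lt (mk_Iio_ord_toType_lt β)
        (p := fun s γ => e γ.1 ∈ s.1) fun γ => hU.fine _] with s hs β' hβ' γ hγ
      exact hs ⟨γ, e.injective hβ' ▸ hγ⟩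
    · exact Eventually.of_forall fun s β hβ => absurd ⟨β, hβ⟩ h
  filter_upwards [hlower] with s hs
  have hl : IsLowerSet {β | e β ∈ s.1} := by
    intro β γ hγβ hβ
    rcases hγβ.eq_or_lt with rfl | h
    · exact hβ
    · exact hs _ hβ β rfl γ h
  rcases hl.eq_univ_or_Iio with h | ⟨α, h⟩
  · exfalso
    have hall : ∀ β, e β ∈ s.1 := fun β => by
      have : β ∈ {β | e β ∈ s.1} := h ▸ Set.mem_univ β
      exact this
    have hle : #κ.ord.ToType ≤ #s.1 :=
      mk_le_of_injective (f := fun β => (⟨e β, hall β⟩ : s.1)) fun β γ hβγ =>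
        e.injective (congrArg Subtype.val hβγ)
    rw [mk_ord_toType] at hle
    exact (hle.trans_lt s.2).false
  · exact ⟨α, fun β => Set.ext_iff.1 h β⟩

end IsNormalFineMeasure

/-! ### Reflection from a normal fine measure -/

namespace IsNormalFineMeasure

variable {κ : Cardinal.{u}} {M : Type u} {U : Ultrafilter (SmallSubsets κ M)}
  {L : FirstOrder.Language.{u, u}} [L.Structure M]

theorem eventually_exists_substructure (hU : IsNormalFineMeasure κ M U) (hL : L.card < κ) :
    ∀ᶠ s : SmallSubsets κ M in U, ∃ S : L.Substructure M, (S : Set M) = s.1 := by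
  have hF : #(Σ n, L.Functions n) < κ := by
    refine lt_of_le_of_lt ?_ hL
    exact mk_le_of_injective (f := fun f => (Sum.inl f : L.Symbols)) Sum.inl_injective
  have := hU.eventually_forall_of_card_lt hF
    (p := fun s f => ∀ x : Fin f.1 → M, (∀ i, x i ∈ s.1) → Language.Structure.funMap f.2 x ∈ s.1)
    fun f => hU.eventually_forall_tuple fun x => hU.fine _
  filter_upwards [this] with s hs
  exact ⟨⟨s.1, fun {n} f x hx => hs ⟨n, f⟩ x hx⟩, rfl⟩

/-- The Łoś theorem for second-order formulas. A relation quantifier is handled by assigning to a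
choice of relations `Y s` on the small sets `s` the relation `{x | ∀ᶠ s in U, x ∈ Y s}`, whose trace
on almost every `s` is that of `Y s`, by normality. -/
theorem realize_iff_eventually_realizeOn (hU : IsNormalFineMeasure κ M U) (hL : L.card < κ)
    {Γ : List ℕ} {n : ℕ} (φ : SOFormula L Γ n) (ρ : RelAssignment M Γ) (x : Fin n → M) :
    φ.Realize ρ x ↔ ∀ᶠ s : SmallSubsets κ M in U, φ.RealizeOn s.1 ρ x := by
  induction φ with
  | falsum => exact eventually_const.symm
  | equal t₁ t₂ => exact eventually_const.symm
  | rel R ts => exact eventually_const.symm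
  | relVar X ts => exact eventually_const.symm
  | imp φ ψ ihφ ihψ =>
    simp only [SOFormula.Realize, SOFormula.RealizeOn, Ultrafilter.eventually_imp, ihφ, ihψ]
  | all φ ih =>
    simp only [SOFormula.Realize, SOFormula.RealizeOn, ih]
    constructor
    · exact fun h => hU.eventually_forall_mem h
    · intro h a
      filter_upwards [h, hU.fine a] with s hs ha using hs a ha
  | allRel k φ ih =>
    simp only [SOFormula.Realize, SOFormula.RealizeOn, ih]
    constructor
    · intro h
      by_contra hcon
      rw [← Ultrafilter.eventually_not] at hcon
      simp only [not_forall] at hcon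
      have hY : ∀ s : SmallSubsets κ M, ∃ Y : Set (Fin k → M),
          (∃ Y, ¬ φ.RealizeOn s.1 (RelAssignment.cons Y ρ) x) →
            ¬ φ.RealizeOn s.1 (RelAssignment.cons Y ρ) x := fun s => by
        by_cases h : ∃ Y, ¬ φ.RealizeOn s.1 (RelAssignment.cons Y ρ) x
        · exact ⟨h.choose, fun _ => h.choose_spec⟩
        · exact ⟨∅, fun h' => absurd h' h⟩
      choose Y hY using hY
      have htrace : ∀ᶠ s : SmallSubsets κ M in U, ∀ y : Fin k → M, (∀ i, y i ∈ s.1) →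
          (y ∈ Y s ↔ ∀ᶠ t in U, y ∈ Y t) := by
        refine hU.eventually_forall_tuple fun y => ?_
        by_cases hy : ∀ᶠ t in U, y ∈ Y t
        · filter_upwards [hy] with s hs using iff_of_true hs hy
        · filter_upwards [Ultrafilter.eventually_not.2 hy] with s hs using iff_of_false hs hy
      have hfalse : ∀ᶠ _s : SmallSubsets κ M in U, False := by
        filter_upwards [hcon, htrace, h {y | ∀ᶠ t in U, y ∈ Y t},
          hU.eventually_exists_substructure hL, hU.eventually_tuple_mem x] with s hs ht hr hS hx
        obtain ⟨S, hS⟩ := hS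
        refine hY s hs ?_
        have hmem : ∀ m, m ∈ S ↔ m ∈ s.1 := fun m => Set.ext_iff.1 hS m
        rw [← hS] at hr ⊢
        exact (SOFormula.realizeOn_cons_congr S φ ρ (fun i => (hmem _).2 (hx i)) fun y hy =>
          ht y fun i => (hmem _).1 (hy i)).2 hr
      exact hfalse.exists.elim fun _ h => h
    · exact fun h Y => h.mono fun s hs => hs Y

theorem eventually_exists_elementarySubstructure (hU : IsNormalFineMeasure κ M U)
    (hκ : ℵ₀ < κ) (hL : L.card < κ) :
    ∀ᶠ s : SmallSubsets κ M in U, ∃ S : L.ElementarySubstructure M, (S : Set M) = s.1 := by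
  have hφ : #(Σ n, L.BoundedFormula Empty n) < κ := by
    refine Language.BoundedFormula.card_le.trans_lt (max_lt hκ ?_)
    simpa using hL
  have hwit := hU.eventually_forall_of_card_lt
    (ι := Σ n, L.BoundedFormula Empty (n + 1))
    (lt_of_le_of_lt (mk_le_of_injective
      (f := fun φ => (⟨φ.1 + 1, φ.2⟩ : Σ n, L.BoundedFormula Empty n)) (by
        rintro ⟨m, φ⟩ ⟨n, ψ⟩ h
        simp only [Sigma.mk.injEq, add_left_inj] at h
        obtain ⟨rfl, h⟩ := h
        simpa using h)) hφ)
    (p := fun s φ => ∀ x : Fin φ.1 → M, (∀ i, x i ∈ s.1) → ∀ a : M,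
      φ.2.Realize default (Fin.snoc x a : _ → M) →
        ∃ b ∈ s.1, φ.2.Realize default (Fin.snoc x b : _ → M))
    -- normality turns one witness per tuple into witnesses in almost every `s`
    fun φ => hU.eventually_forall_tuple fun x => by
      by_cases h : ∃ a : M, φ.2.Realize default (Fin.snoc x a : _ → M)
      · obtain ⟨a, ha⟩ := h
        filter_upwards [hU.fine a] with s hs _ _ using ⟨a, hs, ha⟩
      · exact Eventually.of_forall fun s a ha => absurd ⟨a, ha⟩ h
  filter_upwards [hU.eventually_exists_substructure hL, hwit] with s ⟨S, hS⟩ hs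
  have hmem : ∀ m, m ∈ S ↔ m ∈ s.1 := fun m => Set.ext_iff.1 hS m
  refine ⟨S.toElementarySubstructure fun n φ x a ha => ?_, hS⟩
  obtain ⟨b, hb, hφb⟩ := hs ⟨n, φ⟩ (fun i => x i) (fun i => (hmem _).1 (x i).2) a ha
  exact ⟨⟨b, (hmem b).2 hb⟩, hφb⟩

theorem reflectsBelow (hU : IsNormalFineMeasure κ M U) (hκ : ℵ₀ < κ) (hL : L.card < κ)
    (e : κ.ord.ToType ↪ M) {φ : SOSentence L} (hφ : φ.IsTrueIn M) : ReflectsBelow κ φ M e := by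
  obtain ⟨s, ⟨S, hS⟩, ⟨α, hα⟩, hs⟩ := ((hU.eventually_exists_elementarySubstructure hκ hL).and
    ((hU.eventually_inter_eq_Iio e).and
      ((hU.realize_iff_eventually_realizeOn hL φ _ _).1 hφ))).exists
  refine ⟨S, ?_, ⟨α, fun β => (Set.ext_iff.1 hS (e β)).trans (hα β)⟩, ?_⟩
  · have : #(S : Set M) < κ := hS ▸ s.2
    exact this
  · rw [← hS] at hs
    have := (SOFormula.realizeOn_iff_realize (S : L.Substructure M) φ (RelAssignment.nil M)
      Fin.elim0).1 (by
        have hnil : (fun i => ((Fin.elim0 : Fin 0 → S) i : M)) = Fin.elim0 :=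
          funext fun i => i.elim0
        erw [hnil]
        exact hs)
    rw [RelAssignment.restrict_nil] at this
    exact this

end IsNormalFineMeasure

theorem IsSupercompact.isSecondOrderReflective {κ : Cardinal.{u}} (h : IsSupercompact κ) :
    IsSecondOrderReflective κ := by
  intro L hL M _ e φ hφ
  have hM : κ ≤ #M := by
    have := mk_le_of_injective e.injective
    rwa [mk_ord_toType] at this
  obtain ⟨U, hU⟩ := h.2 M hM
  exact hU.reflectsBelow h.1 hL e hφ

/-! ### Uncountability of reflective cardinals -/

/-- Reflecting a tautology from the pure set `κ` gives an elementary substructure with fewer than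
`κ` elements, which is impossible when the size of `κ` is described by first-order sentences. -/
theorem IsPi11Reflective.aleph0_lt {κ : Cardinal.{u}} (h : IsPi11Reflective κ) (hκ : κ ≠ 0) :
    ℵ₀ < κ := by
  by_contra! hle
  -- the language without symbols
  let L : FirstOrder.Language.{u, u} := ⟨fun _ => PEmpty, fun _ => PEmpty⟩
  have hL : L.card < κ := by
    have : IsEmpty L.Symbols := by
      constructor
      rintro (⟨_, f⟩ | ⟨_, f⟩) <;> exact f.elim
    have h0 : L.card = 0 := mk_eq_zero_iff.2 this
    rw [h0]
    exact pos_iff_ne_zero.2 hκ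
  let : L.Structure κ.ord.ToType := ⟨fun f _ => f.elim, fun r _ => r.elim⟩
  obtain ⟨m, hm, -, -⟩ := h L hL κ.ord.ToType (Function.Embedding.refl _)
    (SOFormula.imp .falsum .falsum) (.of_isFirstOrder ⟨trivial, trivial⟩) (fun h => h)
  obtain ⟨k, hk⟩ := lt_aleph0.1 (hm.trans_le hle)
  have hM : κ.ord.ToType ⊨ Language.Sentence.cardGe L (k + 1) := by
    rw [Language.Sentence.realize_cardGe, mk_ord_toType, Nat.cast_add, Nat.cast_one, ← hk]
    exact add_one_le_of_lt hm
  rw [← m.realize_sentence, Language.Sentence.realize_cardGe, hk] at hM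
  exact absurd (Nat.cast_le.1 hM) (by omega)

/-! ### Families approximated by points -/

section Approximation

variable {κ : Cardinal.{u}} {A : Type u}

/-- `t` is closed downwards in the copy of `κ` given by `e`, contains `c`, and the membership in `D`
of each set `F n a` with `a ∈ t` is that in the principal ultrafilter at `t`. -/
structure Approximates (e : κ.ord.ToType ↪ A) (D : Set (Set (SmallSubsets κ A))) (c : A)
    (F : ℕ → A → Set (SmallSubsets κ A)) (t : SmallSubsets κ A) : Prop where
  mem : c ∈ t.1
  lower : ∀ β γ, γ < β → e β ∈ t.1 → e γ ∈ t.1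
  mem_iff : ∀ n, ∀ a ∈ t.1, F n a ∈ D ↔ t ∈ F n a

/-- A normal ultrafilter containing `{s | ∀ γ < β, e γ ∈ s}` for each `β < κ` is `κ`-complete:
if fewer than `κ` sets were a counterexample, an index of a set missing `s` would be a regressive
function of `s`. -/
theorem cardinalInterFilter_of_normal (e : κ.ord.ToType ↪ A) (U : Ultrafilter (SmallSubsets κ A))
    (hseg : ∀ β, {s : SmallSubsets κ A | ∀ γ < β, e γ ∈ s.1} ∈ U)
    (hnormal : ∀ f : SmallSubsets κ A → A, {s : SmallSubsets κ A | f s ∈ s.1} ∈ U →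
      ∃ a : A, {s : SmallSubsets κ A | f s = a} ∈ U) :
    CardinalInterFilter (U : Filter (SmallSubsets κ A)) κ := by
  classical
  refine ⟨fun S hS hSU => ?_⟩
  by_contra hcon
  have hcompl : (⋂₀ S)ᶜ ∈ U := Ultrafilter.compl_mem_iff_notMem.2 hcon
  obtain ⟨g⟩ : Nonempty (S ≃ (#S).ord.ToType) := Cardinal.eq.1 (mk_ord_toType _).symm
  obtain ⟨p⟩ := Ordinal.type_lt_iff.1 (show Ordinal.type (α := (#S).ord.ToType) (· < ·) <
    Ordinal.type (α := κ.ord.ToType) (· < ·) by simpa using hS)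
  have hmiss : ∀ s : SmallSubsets κ A, ∃ X : Set (SmallSubsets κ A), s ∈ (⋂₀ S)ᶜ →
      X ∈ S ∧ s ∉ X := by
    intro s
    by_cases hs : s ∈ (⋂₀ S)ᶜ
    · simp only [Set.mem_compl_iff, Set.mem_sInter, not_forall] at hs
      obtain ⟨X, hX, hsX⟩ := hs
      exact ⟨X, fun _ => ⟨hX, hsX⟩⟩
    · exact ⟨∅, fun h => absurd h hs⟩
  choose X hX using hmiss
  -- fewer than `κ` indices lie below the single element `p.top` of `κ`, so `hseg` applies
  obtain ⟨a, ha⟩ := hnormal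
    (fun s => if h : X s ∈ S then e (p (g ⟨X s, h⟩)) else e p.top) (by
      filter_upwards [hcompl, hseg p.top] with s hs hseg
      simp only [(hX s hs).1, dite_true]
      exact hseg _ (p.lt_top _))
  obtain ⟨s₀, hs₀, hc₀⟩ := U.nonempty_of_mem (inter_mem ha hcompl)
  have hX₀ := (hX s₀ hc₀).1
  obtain ⟨s, ⟨hs, hc⟩, hsX⟩ := U.nonempty_of_mem
    (inter_mem (inter_mem ha hcompl) (hSU _ hX₀))
  have hXs := (hX s hc).1
  simp only [Set.mem_ofPred_eq, hX₀, dite_true] at hs₀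
  simp only [Set.mem_ofPred_eq, hXs, dite_true] at hs
  have heq : X s = X s₀ := congrArg Subtype.val
    (g.injective (p.injective (e.injective (hs.trans hs₀.symm))))
  exact (hX s hc).2 (heq ▸ hsX)

/-- Each defining property of a normal fine measure fails, if it does, because of at most three
`A`-indexed families of sets, so that it holds of `D` when it holds of a principal ultrafilter
which agrees with `D` on those. -/
theorem exists_isNormalFineMeasure_of_approximates [Nonempty A] (e : κ.ord.ToType ↪ A)
    (D : Set (Set (SmallSubsets κ A))) (hD : ∀ c F, ∃ t, Approximates e D c F t) :
    ∃ U : Ultrafilter (SmallSubsets κ A), IsNormalFineMeasure κ A U := by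
  have hthree : ∀ X Y Z : Set (SmallSubsets κ A),
      ∃ t, (X ∈ D ↔ t ∈ X) ∧ (Y ∈ D ↔ t ∈ Y) ∧ (Z ∈ D ↔ t ∈ Z) := by
    intro X Y Z
    obtain ⟨t, ht⟩ := hD (Classical.arbitrary A) fun n _ =>
      match n with
      | 0 => X
      | 1 => Y
      | _ => Z
    exact ⟨t, ht.mem_iff 0 _ ht.mem, ht.mem_iff 1 _ ht.mem, ht.mem_iff 2 _ ht.mem⟩
  let G : Filter (SmallSubsets κ A) :=
    { sets := D
      univ_sets := by
        obtain ⟨t, ht, -, -⟩ := hthree Set.univ ∅ ∅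
        exact ht.2 trivial
      sets_of_superset := by
        intro X Y hX hXY
        obtain ⟨t, h1, h2, -⟩ := hthree X Y ∅
        exact h2.2 (hXY (h1.1 hX))
      inter_sets := by
        intro X Y hX hY
        obtain ⟨t, h1, h2, h3⟩ := hthree X Y (X ∩ Y)
        exact h3.2 ⟨h1.1 hX, h2.1 hY⟩ }
  let U : Ultrafilter (SmallSubsets κ A) := Ultrafilter.ofComplNotMemIff G (by
    intro X
    obtain ⟨t, h1, h2, -⟩ := hthree X Xᶜ ∅
    exact (not_congr h2).trans (not_not.trans h1.symm))
  have hUD : ∀ X, X ∈ U ↔ X ∈ D := fun X => Iff.rfl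
  have hnormal : ∀ f : SmallSubsets κ A → A, {s : SmallSubsets κ A | f s ∈ s.1} ∈ U →
      ∃ a : A, {s : SmallSubsets κ A | f s = a} ∈ U := by
    intro f hf
    obtain ⟨t, ht⟩ := hD (Classical.arbitrary A) fun n a =>
      match n with
      | 0 => {s | f s ∈ s.1}
      | _ => {s | f s = a}
    have hft : f t ∈ t.1 := (ht.mem_iff 0 _ ht.mem).1 hf
    exact ⟨f t, (ht.mem_iff 1 (f t) hft).2 rfl⟩
  refine ⟨U, cardinalInterFilter_of_normal e U (fun β => ?_) hnormal, fun a => ?_, hnormal⟩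
  · obtain ⟨t, ht⟩ := hD (e β) fun _ _ => {s | ∀ γ < β, e γ ∈ s.1}
    exact (ht.mem_iff 0 _ ht.mem).2 fun γ hγ => ht.lower β γ hγ ht.mem
  · obtain ⟨t, ht⟩ := hD a fun _ _ => {s | a ∈ s.1}
    exact (ht.mem_iff 0 _ ht.mem).2 ht.mem

end Approximation

/-! ### The comprehension sentence -/

/-- The language for `FamilyUniverse`: a unary function, countably many binary functions, a unary
relation ("is a set") and a binary relation (membership). -/
def familyLanguage : FirstOrder.Language.{u, u} where
  Functions
    | 1 => PUnit
    | 2 => ULift ℕ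
    | _ => PEmpty
  Relations
    | 1 => PUnit
    | 2 => PUnit
    | _ => PEmpty

theorem card_familyLanguage_le : familyLanguage.{u}.card ≤ ℵ₀ := by
  have hF : ∀ n, Countable (familyLanguage.{u}.Functions n)
    | 0 => inferInstanceAs (Countable PEmpty)
    | 1 => inferInstanceAs (Countable PUnit)
    | 2 => inferInstanceAs (Countable (ULift ℕ))
    | _ + 3 => inferInstanceAs (Countable PEmpty)
  have hR : ∀ n, Countable (familyLanguage.{u}.Relations n)
    | 0 => inferInstanceAs (Countable PEmpty)
    | 1 => inferInstanceAs (Countable PUnit)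
    | 2 => inferInstanceAs (Countable PUnit)
    | _ + 3 => inferInstanceAs (Countable PEmpty)
  have : Countable familyLanguage.{u}.Symbols := inferInstanceAs
    (Countable ((Σ n, familyLanguage.Functions n) ⊕ Σ n, familyLanguage.Relations n))
  exact mk_le_aleph0

namespace familyLanguage

/-- The unary predicate "`x` is a set". -/
def isSet : familyLanguage.{u}.Relations 1 := PUnit.unit

/-- The binary membership relation. -/
def mem : familyLanguage.{u}.Relations 2 := PUnit.unit

/-- The unary function symbol. -/
def point : familyLanguage.{u}.Functions 1 := PUnit.unit

/-- The `n`-th binary function symbol. -/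
def test (n : ℕ) : familyLanguage.{u}.Functions 2 := ULift.up n

/-- The `Π¹₁` sentence `∀ Y, ∃ u, ∀ x, isSet x → (Y x ↔ mem x u)`, written with `→` and `⊥`:
every class of sets is a family. -/
def comprehension : SOSentence familyLanguage.{u} :=
  .allRel 1 <| .imp
    (.all <| .imp
      (.all <| .imp (.rel isSet fun _ => .var 1) <|
        .imp
          (.imp (.imp (.relVar .zero fun _ => .var 1) (.rel mem ![.var 1, .var 0])) <|
            .imp (.imp (.rel mem ![.var 1, .var 0]) (.relVar .zero fun _ => .var 1)) .falsum)
          .falsum)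
      .falsum)
    .falsum

theorem isPi11_comprehension : SOFormula.IsPi11 comprehension.{u} := by
  refine .allRel 1 (.of_isFirstOrder ?_)
  simp [SOFormula.IsFirstOrder]

theorem isTrueIn_comprehension_iff (N : Type u) [familyLanguage.{u}.Structure N] :
    comprehension.IsTrueIn N ↔ ∀ Y : Set (Fin 1 → N), ∃ u : N, ∀ x : N,
      Language.Structure.RelMap isSet (fun _ => x) →
        ((fun _ => x) ∈ Y ↔ Language.Structure.RelMap mem ![x, u]) := by
  have hpair : ∀ u x : N, (fun i => ((![.var 1, .var 0] :
      Fin 2 → familyLanguage.{u}.Term (Fin 2)) i).realize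
        (Fin.snoc (Fin.snoc (Fin.elim0 : Fin 0 → N) u : Fin 1 → N) x : Fin 2 → N)) = ![x, u] := by
    intro u x
    funext i
    fin_cases i <;> rfl
  have hone : ∀ u x : N, (Fin.snoc (Fin.snoc (Fin.elim0 : Fin 0 → N) u : Fin 1 → N) x :
      Fin 2 → N) 1 = x := fun _ _ => rfl
  simp only [SOSentence.IsTrueIn, comprehension, SOFormula.Realize, RelAssignment.cons, hpair,
    Language.Term.realize_var, hone]
  refine forall_congr' fun Y => ?_
  constructor
  · intro h
    by_contra hcon
    push Not at hcon
    refine h fun u hu => ?_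
    obtain ⟨x, hx, hne⟩ := hcon u
    exact hu x hx fun h1 h2 => by tauto
  · rintro ⟨u, hu⟩ h
    exact h u fun x hx hcon => hcon (hu x hx).1 (hu x hx).2

end familyLanguage

/-! ### A normal fine measure from reflection -/

/-- The three-sorted universe of the points of `A`, the sets of small subsets of `A` and the
families of such sets. -/
inductive FamilyUniverse (κ : Cardinal.{u}) (A : Type u) : Type u
  | point (a : A)
  | set (X : Set (SmallSubsets κ A))
  | family (D : Set (Set (SmallSubsets κ A)))

namespace FamilyUniverse

variable {κ : Cardinal.{u}} {A : Type u}

/-- The family coded by an element, the elements of the other sorts coding the empty family. -/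
def decode : FamilyUniverse κ A → Set (Set (SmallSubsets κ A))
  | family D => D
  | _ => ∅

/-- The structure on `FamilyUniverse κ A` whose functions are `c` and the `F n`, as functions of a
family and a point. Binary functions at a second argument that is not a point return it. -/
abbrev toStructure (c : Set (Set (SmallSubsets κ A)) → A)
    (F : Set (Set (SmallSubsets κ A)) → ℕ → A → Set (SmallSubsets κ A)) :
    familyLanguage.{u}.Structure (FamilyUniverse κ A) where
  funMap {k} f x :=
    match k, f, x with
    | 0, f, _ => PEmpty.elim f
    | 1, _, x => point (c (x 0).decode)
    | 2, n, x =>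
      match x 1 with
      | point a => set (F (x 0).decode (ULift.down n) a)
      | y => y
    | _ + 3, f, _ => PEmpty.elim f
  RelMap {k} r x :=
    match k, r, x with
    | 0, r, _ => PEmpty.elim r
    | 1, _, x => ∃ X, x 0 = set X
    | 2, _, x => ∃ X, x 0 = set X ∧ X ∈ (x 1).decode
    | _ + 3, r, _ => PEmpty.elim r

end FamilyUniverse

open FamilyUniverse in
/-- Given for each family `D` data `c D` and `F D`, some family has an approximating point for its
own data: reflect the comprehension sentence to `m`, let `t` be the set of points in `m`, and take
a family in `m` whose members among the sets in `m` are those to which `t` belongs. -/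
theorem IsPi11Reflective.exists_approximates {κ : Cardinal.{u}} (h : IsPi11Reflective κ)
    (hκ : ℵ₀ < κ) {A : Type u} (e : κ.ord.ToType ↪ A)
    (c : Set (Set (SmallSubsets κ A)) → A)
    (F : Set (Set (SmallSubsets κ A)) → ℕ → A → Set (SmallSubsets κ A)) :
    ∃ D t, Approximates e D (c D) (F D) t := by
  let := toStructure c F
  have htrue : familyLanguage.comprehension.IsTrueIn (FamilyUniverse κ A) := by
    rw [familyLanguage.isTrueIn_comprehension_iff]
    intro Y
    refine ⟨family {X | (fun _ => set X) ∈ Y}, ?_⟩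
    rintro x ⟨X, rfl⟩
    constructor
    · exact fun hX => ⟨X, rfl, hX⟩
    · rintro ⟨X', hX', hmem⟩
      cases hX'
      exact hmem
  obtain ⟨m, hm, ⟨α, hα⟩, hφ⟩ := h familyLanguage (card_familyLanguage_le.trans_lt hκ)
    (FamilyUniverse κ A) (e.trans ⟨point, fun a b hab => by cases hab; rfl⟩)
    familyLanguage.comprehension familyLanguage.isPi11_comprehension htrue
  have hpoint : ∀ u ∈ m, point (c u.decode) ∈ m := fun u hu =>
    m.toSubstructure.fun_mem familyLanguage.point (fun _ => u) fun _ => hu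
  have htest : ∀ u ∈ m, ∀ n a, point a ∈ m → set (F u.decode n a) ∈ m := fun u hu n a ha =>
    m.toSubstructure.fun_mem (familyLanguage.test n) ![u, point a] (by
      intro i
      fin_cases i
      exacts [hu, ha])
  have hcard : #{a : A | point a ∈ m} < κ := by
    refine lt_of_le_of_lt (mk_le_of_injective
      (f := fun a : {a : A | point a ∈ m} => (⟨point a.1, a.2⟩ : m)) fun a b hab => ?_) hm
    have := congrArg Subtype.val hab
    simp only [point.injEq] at this
    exact Subtype.ext this
  let t : SmallSubsets κ A := ⟨{a | point a ∈ m}, hcard⟩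
  rw [familyLanguage.isTrueIn_comprehension_iff] at hφ
  obtain ⟨u, hu⟩ := hφ {y | ∃ X, (y 0).1 = set X ∧ t ∈ X}
  have hmem : ∀ X, set X ∈ m → (X ∈ u.1.decode ↔ t ∈ X) := by
    intro X hX
    have := hu ⟨set X, hX⟩ ⟨X, rfl⟩
    constructor
    · intro hXu
      obtain ⟨X', hX', htX⟩ := this.2 ⟨X, rfl, hXu⟩
      cases hX'
      exact htX
    · intro htX
      obtain ⟨X', hX', hXu⟩ := this.1 ⟨X, rfl, htX⟩
      cases hX'
      exact hXu
  exact ⟨u.1.decode, t, hpoint u u.2, fun β γ hγ hβ => (hα γ).2 (hγ.trans ((hα β).1 hβ)),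
    fun n a ha => hmem _ (htest u u.2 n a ha)⟩

theorem IsPi11Reflective.isSupercompact {κ : Cardinal.{u}} (h : IsPi11Reflective κ) (hκ : κ ≠ 0) :
    IsSupercompact κ := by
  have hω := h.aleph0_lt hκ
  refine ⟨hω, fun A hA => ?_⟩
  obtain ⟨e⟩ : Nonempty (κ.ord.ToType ↪ A) := by
    rwa [← mk_ord_toType κ] at hA
  have : Nonempty A := mk_ne_zero_iff.1 fun h0 => hκ (le_zero_iff.1 (h0 ▸ hA))
  by_contra hcon
  have hbad : ∀ D : Set (Set (SmallSubsets κ A)), ∃ c F, ∀ t, ¬ Approximates e D c F t := by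
    intro D
    by_contra! hD
    exact hcon (exists_isNormalFineMeasure_of_approximates e D hD)
  choose c F hbad using hbad
  -- the chosen counterexamples serve as Skolem functions for the failure of each family
  obtain ⟨D, t, ht⟩ := h.exists_approximates hω e c F
  exact hbad D t ht

theorem mainTheorem3 (κ : Cardinal.{u}) (hκ : κ ≠ 0) :
    List.TFAE [IsSecondOrderReflective κ, IsPi11Reflective κ, IsSupercompact κ] := by
  tfae_have 1 → 2 := fun h L hL M _ e φ _ hφ => h L hL M e φ hφ
  tfae_have 2 → 3 := fun h => h.isSupercompact hκ
  tfae_have 3 → 1 := fun h => h.isSecondOrderReflective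
  tfae_finish
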